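/- **Theorem (Finite-$n$ Probability Bound).** There are universal constants $c, C > 0$ such that the following holds. Let $n \ge 2$, let $\mathbf 1 \in \mathbb R^n$ be the all-ones vector, $\mathcal V_\perp = \mathbf 1^\perp$ and $\mathcal P_\perp = I_n - \frac1n \mathbf 1 \mathbf 1^\top$. Let $M \in \mathbb R^{n\times n}$ be a primitive doubly stochastic matrix, let $x_\perp, x'_\perp \in \mathcal V_\perp$, let $\nu > 0$, and let $\xi, \xi'$ be independent random vectors with law $\mathcal N(0, \frac{\nu^2}{n} I_n)$. Write $\mathrm{LN}(y) = \sqrt n\, \mathcal P_\perp y / \|\mathcal P_\perp y\|_2$ for layer normalization, and let $$u = \tfrac{1}{\sqrt n}\,\mathrm{LN}(M x_\perp + \xi), \qquad v = \tfrac{1}{\sqrt n}\,\mathrm{LN}(M x'_\perp + \xi')$$ be the normalized outputs, rescaled to unit length. (They are defined almost surely.) Let $$\gamma = \max\left(\frac{\|M x_\perp\|_2}{\mathbb E\,\|\mathcal P_\perp \xi\|_2},\ \frac{\|M x'_\perp\|_2}{\mathbb E\,\|\mathcal P_\perp \xi'\|_2}\right)$$ be the larger of the two signal-to-noise ratios,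 and assume $\gamma \le 1/8$. Then for all $\epsilon > 0$ and $\delta \in (0,1)$, $$\mathbb P\big( |\langle u, v\rangle| \le \epsilon + 8\gamma \big) \ \ge\ 1 - \delta - C e^{-c n \epsilon^2}.$$ -/

import Mathlib

open MeasureTheory ProbabilityTheory

noncomputable section

namespace Collapse

/-- The space `ℝⁿ` with its Euclidean norm and inner product. -/
abbrev Vec (n : ℕ) : Type := EuclideanSpace ℝ (Fin n)

/-- The all-ones vector `𝟏 ∈ ℝⁿ`. -/
def ones (n : ℕ) : Vec n := WithLp.toLp 2 (fun _ => (1 : ℝ))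

/-- The detail subspace `V_⊥ = 𝟏^⊥`. -/
def detailSubspace (n : ℕ) : Submodule ℝ (Vec n) := (Submodule.span ℝ {ones n})ᗮ

/-- The linear map of `ℝⁿ` given by an `n × n` matrix. -/
def act {n : ℕ} (A : Matrix (Fin n) (Fin n) ℝ) : Vec n →L[ℝ] Vec n :=
  Matrix.toEuclideanCLM (n := Fin n) (𝕜 := ℝ) A

/-- The projection onto the detail subspace, `P_⊥ = I - (1/n) 𝟏 𝟏ᵀ`. -/
def detailProj (n : ℕ) : Vec n →L[ℝ] Vec n :=
  act (1 - (1 / (n : ℝ)) • Matrix.of (fun _ _ => (1 : ℝ)))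

/-- Layer normalization without affine parameters, `LN(y) = √n • P_⊥ y / ‖P_⊥ y‖`. -/
def layerNorm {n : ℕ} (y : Vec n) : Vec n :=
  (Real.sqrt n / ‖detailProj n y‖) • detailProj n y

/-- The normalized output for the detail component `x` and the noise value `z`: the layer
normalization of `y = M x + z`, rescaled from radius `√n` to the unit sphere. -/
def normalizedOutput {n : ℕ} (M : Matrix (Fin n) (Fin n) ℝ) (x z : Vec n) : Vec n :=
  (Real.sqrt n)⁻¹ • layerNorm (act M x + z)

/-- The signal-to-noise ratio `‖M x‖ / 𝔼 ‖P_⊥ ξ‖` of the detail component `x` under the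
noise `ξ`. -/
def snr {Ω : Type*} [MeasurableSpace Ω] (P : Measure Ω) {n : ℕ}
    (M : Matrix (Fin n) (Fin n) ℝ) (x : Vec n) (ξ : Ω → Vec n) : ℝ :=
  ‖act M x‖ / ∫ ω, ‖detailProj n (ξ ω)‖ ∂P

/-- The isotropic Gaussian law `N(0, (ν² / n) Iₙ)`. -/
def noiseLaw (n : ℕ) (ν : ℝ) : Measure (Vec n) :=
  multivariateGaussian 0 ((ν ^ 2 / (n : ℝ)) • (1 : Matrix (Fin n) (Fin n) ℝ))

end Collapse

end

/-! Write `ξ = (ν / √n) • ζ` with `ζ` standard Gaussian. Since `𝔼 ‖P_⊥ ξ‖ ≤ ν`, the signal satisfies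
`‖M x‖ ≤ γ ν` (`norm_act_le`), while `‖P_⊥ ξ‖ ≥ ν / 2` outside an event of probability `3
exp(-n/16)` (`stdGaussian_norm_detailProj_lt`). Normalization moves by at most twice the relative
perturbation, so each output lies within `4γ` of the pure noise direction; the two errors add up to
`8γ`.

It remains to see that independent noise directions are nearly orthogonal. With `ζ` fixed,
`⟪detailDir ζ, ζ'⟫` is a centred Gaussian of variance at most one
(`measure_le_abs_inner_detailDir`), and dividing by `‖P_⊥ ζ'‖ ≥ √n / 2` makes it of order `1 / √n`.
A union bound concludes. -/

namespace Collapse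

open Real
open scoped RealInnerProductSpace

variable {n : ℕ}

/-! ### The projection onto the detail subspace -/

lemma detailProj_apply (y : Vec n) :
    detailProj n y = y - ((1 / (n : ℝ)) * ⟪ones n, y⟫) • ones n := by
  ext i
  simp [detailProj, act, ones, Matrix.mulVec, dotProduct, PiLp.inner_apply,
    Finset.mul_sum]

lemma inner_ones_ones : ⟪ones n, ones n⟫ = (n : ℝ) := by
  simp only [ones, PiLp.inner_apply]
  simp

lemma norm_ones_sq : ‖ones n‖ ^ 2 = (n : ℝ) := by
  rw [← real_inner_self_eq_norm_sq, inner_ones_ones]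

lemma inner_detailProj_comm (y z : Vec n) :
    ⟪detailProj n y, z⟫ = ⟪y, detailProj n z⟫ := by
  simp only [detailProj_apply, inner_sub_left, inner_sub_right, real_inner_smul_left,
    real_inner_smul_right, real_inner_comm (ones n) y]
  ring

lemma detailProj_detailProj (hn : n ≠ 0) (y : Vec n) :
    detailProj n (detailProj n y) = detailProj n y := by
  have hn' : (n : ℝ) ≠ 0 := by exact_mod_cast hn
  have h : ⟪ones n, detailProj n y⟫ = 0 := by
    rw [detailProj_apply, inner_sub_right, real_inner_smul_right, inner_ones_ones]
    field_simp
    ring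
  rw [detailProj_apply (detailProj n y), h]
  simp

lemma norm_detailProj_sq (hn : n ≠ 0) (y : Vec n) :
    ‖detailProj n y‖ ^ 2 = ‖y‖ ^ 2 - ⟪ones n, y⟫ ^ 2 / n := by
  have hn' : (n : ℝ) ≠ 0 := by exact_mod_cast hn
  rw [← real_inner_self_eq_norm_sq, inner_detailProj_comm, detailProj_detailProj hn,
    detailProj_apply, inner_sub_right, real_inner_smul_right, real_inner_self_eq_norm_sq,
    real_inner_comm (ones n) y]
  ring

lemma norm_detailProj_le (hn : n ≠ 0) (y : Vec n) : ‖detailProj n y‖ ≤ ‖y‖ := by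
  refine le_of_sq_le_sq ?_ (norm_nonneg _)
  rw [norm_detailProj_sq hn]
  have : 0 ≤ ⟪ones n, y⟫ ^ 2 / n := by positivity
  linarith

/-! ### Normalization of vectors -/

section normalize

variable {E : Type*} [NormedAddCommGroup E] [InnerProductSpace ℝ E]

lemma norm_inv_norm_smul_le (y : E) : ‖‖y‖⁻¹ • y‖ ≤ 1 := by
  rw [norm_smul, norm_inv, norm_norm]
  exact inv_mul_le_one

/-- Normalization is stable under perturbations that are small relative to the norm. -/
lemma norm_inv_norm_smul_sub_le (a : E) {g : E} (hg : g ≠ 0) :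
    ‖‖a + g‖⁻¹ • (a + g) - ‖g‖⁻¹ • g‖ ≤ 2 * ‖a‖ / ‖g‖ := by
  set y := a + g with hy
  have hg0 : 0 < ‖g‖ := norm_pos_iff.2 hg
  have hyy : ‖y‖ • (‖y‖⁻¹ • y) = y := by
    rcases eq_or_ne y 0 with h | h
    · simp [h]
    · rw [smul_smul, mul_inv_cancel₀ (norm_ne_zero_iff.2 h), one_smul]
  -- Both terms on the right have norm at most `‖a‖`, whence the factor 2. The identity survives `y
  -- = 0`, where the normalized vector is `0`.
  have key : ‖g‖ • (‖y‖⁻¹ • y - ‖g‖⁻¹ • g) = (‖g‖ - ‖y‖) • (‖y‖⁻¹ • y) + a := by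
    rw [sub_smul, hyy, smul_sub, smul_smul ‖g‖ ‖g‖⁻¹, mul_inv_cancel₀ hg0.ne', one_smul, hy]
    abel
  rw [le_div_iff₀' hg0]
  calc ‖g‖ * ‖‖y‖⁻¹ • y - ‖g‖⁻¹ • g‖ = ‖‖g‖ • (‖y‖⁻¹ • y - ‖g‖⁻¹ • g)‖ := by
        rw [norm_smul, norm_norm]
    _ ≤ ‖(‖g‖ - ‖y‖) • (‖y‖⁻¹ • y)‖ + ‖a‖ := key ▸ norm_add_le _ _
    _ ≤ ‖a‖ * 1 + ‖a‖ := by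
        gcongr
        rw [norm_smul]
        gcongr
        · calc ‖‖g‖ - ‖y‖‖ ≤ ‖g - y‖ := abs_norm_sub_norm_le g y
            _ = ‖a‖ := by rw [hy, sub_add_cancel_right, norm_neg]
        · exact norm_inv_norm_smul_le y
    _ = 2 * ‖a‖ := by ring

lemma abs_inner_le_of_norm_sub_le {u v p q : E} {r s : ℝ} (hv : ‖v‖ ≤ 1) (hp : ‖p‖ ≤ 1)
    (hu : ‖u - p‖ ≤ r) (hq : ‖v - q‖ ≤ s) : |⟪u, v⟫| ≤ |⟪p, q⟫| + r + s := by
  have h : ⟪u, v⟫ = ⟪p, q⟫ + ⟪u - p, v⟫ + ⟪p, v - q⟫ := by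
    rw [inner_sub_left, inner_sub_right]
    ring
  have h1 : |⟪u - p, v⟫| ≤ r := by
    refine (abs_real_inner_le_norm _ _).trans ?_
    nlinarith [norm_nonneg (u - p), norm_nonneg v]
  have h2 : |⟪p, v - q⟫| ≤ s := by
    refine (abs_real_inner_le_norm _ _).trans ?_
    nlinarith [norm_nonneg (v - q), norm_nonneg p]
  rw [h]
  exact (abs_add_le _ _).trans (add_le_add ((abs_add_le _ _).trans (by linarith)) h2)

end normalize

lemma normalizedOutput_eq (hn : n ≠ 0) (M : Matrix (Fin n) (Fin n) ℝ) (x z : Vec n) :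
    normalizedOutput M x z =
      ‖detailProj n (act M x) + detailProj n z‖⁻¹ •
        (detailProj n (act M x) + detailProj n z) := by
  have hn' : √(n : ℝ) ≠ 0 := (Real.sqrt_pos.2 (by positivity)).ne'
  rw [normalizedOutput, layerNorm, map_add, smul_smul]
  congr 1
  field_simp

lemma norm_normalizedOutput_le (hn : n ≠ 0) (M : Matrix (Fin n) (Fin n) ℝ) (x z : Vec n) :
    ‖normalizedOutput M x z‖ ≤ 1 := by
  rw [normalizedOutput_eq hn]
  exact norm_inv_norm_smul_le _

/-- The direction of the detail component of `z`. -/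
noncomputable def detailDir (z : Vec n) : Vec n := ‖detailProj n z‖⁻¹ • detailProj n z

lemma detailDir_smul {s : ℝ} (hs : 0 < s) (z : Vec n) : detailDir (s • z) = detailDir z := by
  rw [detailDir, detailDir, map_smul, norm_smul, smul_smul, Real.norm_of_nonneg hs.le, mul_inv,
    mul_right_comm, inv_mul_cancel₀ hs.ne', one_mul]

lemma norm_detailDir_le (z : Vec n) : ‖detailDir z‖ ≤ 1 := norm_inv_norm_smul_le _

lemma measurable_detailDir : Measurable (detailDir : Vec n → Vec n) := by
  unfold detailDir
  fun_prop

/-- `P_⊥` is self-adjoint and fixes `detailDir y`, so it can be dropped from the second argument.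
What remains is linear in `z`, up to the norm factor. -/
lemma inner_detailDir_detailDir (hn : n ≠ 0) (y z : Vec n) :
    ⟪detailDir y, detailDir z⟫ = ‖detailProj n z‖⁻¹ * ⟪detailDir y, z⟫ := by
  simp only [detailDir, real_inner_smul_left, real_inner_smul_right]
  rw [← inner_detailProj_comm, detailProj_detailProj hn]

lemma norm_normalizedOutput_sub_detailDir_le (hn : n ≠ 0) (M : Matrix (Fin n) (Fin n) ℝ)
    (x : Vec n) {z : Vec n} (hz : detailProj n z ≠ 0) :
    ‖normalizedOutput M x z - detailDir z‖ ≤ 2 * ‖act M x‖ / ‖detailProj n z‖ := by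
  rw [normalizedOutput_eq hn]
  refine (norm_inv_norm_smul_sub_le _ hz).trans ?_
  gcongr
  exact norm_detailProj_le hn _

/-! ### Tail bounds for standard Gaussian vectors -/

instance (ν : ℝ) : IsGaussian (noiseLaw n ν) := by
  unfold noiseLaw
  infer_instance

lemma noiseLaw_eq_map {ν : ℝ} :
    noiseLaw n ν = (stdGaussian (Vec n)).map (fun z ↦ (ν / √n) • z) := by
  apply Measure.ext_of_charFun
  ext t
  have hS : ((ν ^ 2 / (n : ℝ)) • (1 : Matrix (Fin n) (Fin n) ℝ)).PosSemidef :=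
    Matrix.PosSemidef.one.smul (by positivity)
  have ht : t.ofLp ⬝ᵥ t.ofLp = ‖t‖ ^ 2 := by
    rw [EuclideanSpace.real_norm_sq_eq, dotProduct]
    simp [sq]
  have hs : (√(n : ℝ)) ^ 2 = n := Real.sq_sqrt (Nat.cast_nonneg n)
  rw [noiseLaw, charFun_multivariateGaussian hS, charFun_map_smul, charFun_stdGaussian]
  rw [Matrix.smul_mulVec, Matrix.one_mulVec, dotProduct_smul, ht, norm_smul]
  have hv : (‖ν / √(n : ℝ)‖ * ‖t‖) ^ 2 = ν ^ 2 / n * ‖t‖ ^ 2 := by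
    rw [mul_pow, Real.norm_eq_abs, sq_abs, div_pow, hs]
  rw [← Complex.ofReal_pow, hv, inner_zero_right, smul_eq_mul]
  simp [neg_div]

lemma map_inner_stdGaussian (w : Vec n) :
    (stdGaussian (Vec n)).map (fun z ↦ ⟪w, z⟫) = gaussianReal 0 (‖w‖ ^ 2).toNNReal := by
  have h := IsGaussian.map_eq_gaussianReal (μ := stdGaussian (Vec n)) (innerSL ℝ w)
  rw [variance_dual_stdGaussian, integral_strongDual_stdGaussian, innerSL_apply_norm] at h
  exact h

lemma hasSubgaussianMGF_inner_stdGaussian {w : Vec n} (hw : ‖w‖ ≤ 1) :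
    HasSubgaussianMGF (fun z ↦ ⟪w, z⟫) 1 (stdGaussian (Vec n)) where
  integrable_exp_mul t := by
    have h := integrable_exp_mul_gaussianReal (μ := 0) (v := (‖w‖ ^ 2).toNNReal) t
    rw [← map_inner_stdGaussian] at h
    exact h.comp_measurable (by fun_prop)
  mgf_le t := by
    rw [mgf_gaussianReal (map_inner_stdGaussian w)]
    have h1 : ‖w‖ ^ 2 ≤ 1 := pow_le_one₀ (norm_nonneg _) hw
    rw [Real.coe_toNNReal _ (by positivity)]
    gcongr
    simp only [zero_mul, zero_add, NNReal.coe_one]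
    gcongr

lemma stdGaussian_le_abs_inner {w : Vec n} (hw : ‖w‖ ≤ 1) {s : ℝ} (hs : 0 ≤ s) :
    (stdGaussian (Vec n)).real {z | s ≤ |⟪w, z⟫|} ≤ 2 * rexp (-s ^ 2 / 2) := by
  have h := hasSubgaussianMGF_inner_stdGaussian hw
  have h1 := h.measure_ge_le hs
  have h2 := h.neg.measure_ge_le hs
  have hsub : {z : Vec n | s ≤ |⟪w, z⟫|} ⊆
      {z | s ≤ ⟪w, z⟫} ∪ {z | s ≤ (-fun z ↦ ⟪w, z⟫) z} := fun z hz ↦ by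
    simpa [le_abs] using hz
  refine (measureReal_mono hsub).trans ((measureReal_union_le _ _).trans ?_)
  simp only [NNReal.coe_one, mul_one] at h1 h2
  linarith

lemma integral_exp_neg_sq_gaussianReal :
    ∫ x, rexp (-x ^ 2 / 2) ∂(gaussianReal 0 1) = (√2)⁻¹ := by
  rw [integral_gaussianReal_eq_integral_smul one_ne_zero]
  have h : ∀ x : ℝ, gaussianPDFReal 0 1 x • rexp (-x ^ 2 / 2) =
      (√(2 * π))⁻¹ * rexp (-1 * x ^ 2) := by
    intro x
    rw [gaussianPDFReal, smul_eq_mul, mul_assoc, ← Real.exp_add]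
    simp only [NNReal.coe_one, sub_zero, mul_one]
    ring_nf
  simp_rw [h]
  rw [integral_const_mul, integral_gaussian, Real.sqrt_mul (by norm_num)]
  have : √π ≠ 0 := by positivity
  simp
  field_simp

lemma integral_exp_neg_norm_sq_stdGaussian :
    ∫ z, rexp (-‖z‖ ^ 2 / 2) ∂(stdGaussian (Vec n)) = (√2)⁻¹ ^ n := by
  rw [← map_pi_eq_stdGaussian, integral_map (by fun_prop) (by fun_prop)]
  have h : ∀ x : Fin n → ℝ, rexp (-‖WithLp.toLp 2 x‖ ^ 2 / 2) = ∏ i, rexp (-(x i) ^ 2 / 2) := by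
    intro x
    rw [EuclideanSpace.real_norm_sq_eq, ← Real.exp_sum, ← Finset.sum_div, Finset.sum_neg_distrib]
  simp_rw [h]
  rw [integral_fintype_prod_eq_pow (fun x : ℝ ↦ rexp (-x ^ 2 / 2)),
    integral_exp_neg_sq_gaussianReal, Fintype.card_fin]

/-- Chernoff bound: Markov's inequality at level `exp(-n/4)` for `exp(-‖z‖²/2)`, whose mean is
`2^(-n/2)`. -/
lemma stdGaussian_norm_sq_le :
    (stdGaussian (Vec n)).real {z | ‖z‖ ^ 2 ≤ n / 2} ≤ rexp (-(n / 16)) := by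
  have hint : Integrable (fun z : Vec n ↦ rexp (-‖z‖ ^ 2 / 2)) (stdGaussian (Vec n)) := by
    refine Integrable.of_bound (by fun_prop) 1 (Filter.Eventually.of_forall fun z ↦ ?_)
    rw [Real.norm_of_nonneg (Real.exp_nonneg _), Real.exp_le_one_iff]
    have := sq_nonneg ‖z‖
    linarith
  have h := mul_meas_ge_le_integral_of_nonneg
    (Filter.Eventually.of_forall fun z ↦ (Real.exp_nonneg _)) hint (rexp (-(n / 4)))
  rw [integral_exp_neg_norm_sq_stdGaussian] at h
  have hsub : {z : Vec n | ‖z‖ ^ 2 ≤ n / 2} ⊆ {z | rexp (-(n / 4)) ≤ rexp (-‖z‖ ^ 2 / 2)} := by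
    intro z hz
    simp only [Set.mem_ofPred_eq, Real.exp_le_exp] at hz ⊢
    linarith
  have hm := measureReal_mono (μ := stdGaussian (Vec n)) hsub
  -- `5/16 = 1/4 + 1/16` pays for the Markov level and leaves the rate `1/16`; it fits because `(log
  -- 2) / 2 > 5/16`.
  have hsqrt : (√2)⁻¹ ≤ rexp (-(5 / 16)) := by
    rw [Real.exp_neg]
    gcongr
    refine Real.le_sqrt_of_sq_le ?_
    rw [← Real.exp_nat_mul, ← Real.le_log_iff_exp_le (by norm_num)]
    have := Real.log_two_gt_d9
    norm_num
    linarith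
  have hpow : (√2)⁻¹ ^ n ≤ rexp (-(n / 4)) * rexp (-(n / 16)) := by
    calc (√2)⁻¹ ^ n ≤ rexp (-(5 / 16)) ^ n := by gcongr
      _ = rexp (-(n / 4)) * rexp (-(n / 16)) := by
        rw [← Real.exp_nat_mul, ← Real.exp_add]
        ring_nf
  exact hm.trans (le_of_mul_le_mul_left (h.trans hpow) (Real.exp_pos _))

/-- By Pythagoras, `‖P_⊥ z‖² = ‖z‖² - ⟪w, z⟫²` with `w` the unit vector along `𝟏`. It can fall below
`n/4` only if `‖z‖² ≤ n/2` or `⟪w, z⟫² ≥ n/4`. -/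
lemma stdGaussian_norm_detailProj_lt (hn : n ≠ 0) :
    (stdGaussian (Vec n)).real {z | ‖detailProj n z‖ < √n / 2} ≤ 3 * rexp (-(n / 16)) := by
  have hn0 : (0 : ℝ) < n := by positivity
  have hs0 : 0 < √(n : ℝ) := Real.sqrt_pos.2 hn0
  have hs : (√(n : ℝ)) ^ 2 = n := Real.sq_sqrt hn0.le
  set w : Vec n := (√n)⁻¹ • ones n with hw
  have hw1 : ‖w‖ ≤ 1 := by
    rw [hw, norm_smul, norm_inv, Real.norm_of_nonneg hs0.le, ← Real.sqrt_sq (norm_nonneg (ones n)),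
      norm_ones_sq, inv_mul_cancel₀ hs0.ne']
  have hsub : {z : Vec n | ‖detailProj n z‖ < √n / 2} ⊆
      {z | ‖z‖ ^ 2 ≤ n / 2} ∪ {z | √n / 2 ≤ |⟪w, z⟫|} := by
    intro z hz
    by_contra hcon
    simp only [Set.mem_union, Set.mem_ofPred_eq, not_or, not_le] at hcon hz
    obtain ⟨h1, h2⟩ := hcon
    have h3 : ‖detailProj n z‖ ^ 2 = ‖z‖ ^ 2 - ⟪w, z⟫ ^ 2 := by
      rw [norm_detailProj_sq hn, hw, real_inner_smul_left, mul_pow, inv_pow, hs]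
      ring
    have h4 : ‖detailProj n z‖ ^ 2 < n / 4 := by
      calc _ < (√n / 2) ^ 2 := by gcongr
        _ = n / 4 := by rw [div_pow, hs]; norm_num
    have h5 : ⟪w, z⟫ ^ 2 < n / 4 := by
      rw [← sq_abs]
      calc _ < (√n / 2) ^ 2 := by gcongr
        _ = n / 4 := by rw [div_pow, hs]; norm_num
    linarith
  refine (measureReal_mono hsub).trans ((measureReal_union_le _ _).trans ?_)
  have h1 := stdGaussian_norm_sq_le (n := n)
  have h2 := stdGaussian_le_abs_inner hw1 (s := √n / 2) (by positivity)
  have h3 : rexp (-(√n / 2) ^ 2 / 2) ≤ rexp (-(n / 16)) := by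
    rw [Real.exp_le_exp, div_pow, hs]
    linarith
  linarith

lemma integral_norm_sq_stdGaussian : ∫ z, ‖z‖ ^ 2 ∂(stdGaussian (Vec n)) = n := by
  have hcoord (i : Fin n) : ∫ z : Vec n, z i ^ 2 ∂(stdGaussian (Vec n)) = 1 := by
    have h := map_inner_stdGaussian (EuclideanSpace.single i (1 : ℝ))
    have h' : (fun z : Vec n ↦ ⟪EuclideanSpace.single i (1 : ℝ), z⟫) = fun z ↦ z i := by
      ext z
      simp [EuclideanSpace.inner_single_left]
    rw [h'] at h
    have h2 := variance_fun_id_gaussianReal (μ := 0) (v := 1)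
    rw [variance_of_integral_eq_zero (by fun_prop) (by simp)] at h2
    rw [← integral_map (φ := fun z : Vec n ↦ z i) (f := fun x : ℝ ↦ x ^ 2) (by fun_prop)
      (by fun_prop), h]
    simpa using h2
  simp_rw [EuclideanSpace.real_norm_sq_eq]
  rw [integral_finsetSum]
  · simp [hcoord]
  · intro i _
    exact (((EuclideanSpace.proj (𝕜 := ℝ) i).comp_memLp'
      (IsGaussian.memLp_two_id (μ := stdGaussian (Vec n)))).integrable_sq)

lemma integrable_norm_detailProj_stdGaussian :
    Integrable (fun z ↦ ‖detailProj n z‖) (stdGaussian (Vec n)) :=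
  ((detailProj n).integrable_comp
    (IsGaussian.integrable_id (μ := stdGaussian (Vec n)))).norm

lemma integral_norm_detailProj_stdGaussian_le (hn : n ≠ 0) :
    ∫ z, ‖detailProj n z‖ ∂(stdGaussian (Vec n)) ≤ √n := by
  have hmem : MemLp (fun z : Vec n ↦ ‖z‖) 2 (stdGaussian (Vec n)) :=
    (IsGaussian.memLp_two_id (μ := stdGaussian (Vec n))).norm
  calc ∫ z, ‖detailProj n z‖ ∂(stdGaussian (Vec n))
      ≤ ∫ z, ‖z‖ ∂(stdGaussian (Vec n)) :=
        integral_mono integrable_norm_detailProj_stdGaussian (hmem.integrable (by norm_num))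
          fun z ↦ norm_detailProj_le hn z
    _ ≤ √n := by
        refine Real.le_sqrt_of_sq_le ?_
        -- Nonnegative variance gives `(𝔼 ‖z‖)² ≤ 𝔼 ‖z‖² = n`.
        have h := variance_nonneg (fun z : Vec n ↦ ‖z‖) (stdGaussian (Vec n))
        rw [variance_eq_sub hmem] at h
        have h2 := integral_norm_sq_stdGaussian (n := n)
        simp only [Pi.pow_apply] at h
        linarith

/-- For `n ≥ 2` the detail subspace contains `e₀ - e₁ ≠ 0`, and the Gaussian has positive variance
along it. Positivity lets `‖M x‖` be recovered from the quotient `snr`. -/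
lemma integral_norm_detailProj_stdGaussian_pos (hn : 2 ≤ n) :
    0 < ∫ z, ‖detailProj n z‖ ∂(stdGaussian (Vec n)) := by
  refine (integral_nonneg fun z ↦ norm_nonneg _).lt_of_ne' fun h0 ↦ ?_
  rw [integral_eq_zero_iff_of_nonneg (fun z ↦ norm_nonneg _)
    integrable_norm_detailProj_stdGaussian] at h0
  set i : Fin n := ⟨0, by omega⟩
  set j : Fin n := ⟨1, by omega⟩
  have hij : i ≠ j := by simp [i, j]
  set w : Vec n := EuclideanSpace.single i (1 : ℝ) - EuclideanSpace.single j (1 : ℝ) with hw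
  have hw0 : w ≠ 0 := by
    intro h
    have := congrArg (fun z : Vec n ↦ z i) h
    simp [hw, hij] at this
  have hPw : detailProj n w = w := by
    rw [detailProj_apply]
    simp [hw, inner_sub_right, ones, EuclideanSpace.inner_single_right]
  have hzero : ∀ᵐ z ∂(stdGaussian (Vec n)), ⟪w, z⟫ = 0 := by
    filter_upwards [h0] with z hz
    have : detailProj n z = 0 := norm_eq_zero.1 hz
    rw [← hPw, inner_detailProj_comm, this, inner_zero_right]
  have hvar : Var[fun z ↦ ⟪w, z⟫; stdGaussian (Vec n)] = ‖w‖ ^ 2 := by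
    rw [← variance_id_map (by fun_prop), map_inner_stdGaussian, variance_id_gaussianReal,
      Real.coe_toNNReal _ (by positivity)]
  rw [variance_congr (Y := 0) hzero, variance_zero] at hvar
  exact hw0 (norm_eq_zero.1 (pow_eq_zero_iff two_ne_zero |>.1 hvar.symm))

/-- A random direction of norm at most one and an independent standard Gaussian vector are nearly
orthogonal. -/
lemma measure_le_abs_inner_detailDir {Ω : Type*} [MeasurableSpace Ω] {P : Measure Ω}
    [IsProbabilityMeasure P] {ζ ζ' : Ω → Vec n} (hζ : HasLaw ζ (stdGaussian (Vec n)) P)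
    (hζ' : HasLaw ζ' (stdGaussian (Vec n)) P) (hind : IndepFun ζ ζ' P) {s : ℝ} (hs : 0 ≤ s) :
    P.real {ω | s ≤ |⟪detailDir (ζ ω), ζ' ω⟫|} ≤ 2 * rexp (-s ^ 2 / 2) := by
  have hlaw := (indepFun_iff_hasLaw_prodMk_prod hζ hζ').1 hind
  have hdir : Measurable (detailDir : Vec n → Vec n) := measurable_detailDir
  have hmeas : MeasurableSet {p : Vec n × Vec n | s ≤ |⟪detailDir p.1, p.2⟫|} :=
    measurableSet_le measurable_const (by fun_prop)
  rw [hlaw.measureReal_eq (p := fun p : Vec n × Vec n ↦ s ≤ |⟪detailDir p.1, p.2⟫|) hmeas]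
  refine ENNReal.toReal_le_of_le_ofReal (by positivity) ?_
  -- Fubini: with the first vector frozen, the one-dimensional tail bound applies uniformly.
  rw [Measure.prod_apply hmeas]
  calc _ ≤ ∫⁻ _, ENNReal.ofReal (2 * rexp (-s ^ 2 / 2)) ∂(stdGaussian (Vec n)) := by
        refine lintegral_mono fun z ↦ ?_
        rw [ENNReal.le_ofReal_iff_toReal_le (measure_ne_top _ _) (by positivity)]
        exact stdGaussian_le_abs_inner (norm_detailDir_le z) hs
    _ = _ := by simp

/-! ### Rescaling the noise -/

section noise

variable {Ω : Type*} [MeasurableSpace Ω] {P : Measure Ω} {ν : ℝ} {ξ : Ω → Vec n}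

lemma hasLaw_inv_smul_noise (hn : n ≠ 0) (hν : 0 < ν) (hξ : HasLaw ξ (noiseLaw n ν) P) :
    HasLaw (fun ω ↦ (ν / √n)⁻¹ • ξ ω) (stdGaussian (Vec n)) P where
  aemeasurable := AEMeasurable.const_smul hξ.aemeasurable (ν / √n)⁻¹
  map_eq := by
    have hs : ν / √(n : ℝ) ≠ 0 := (div_pos hν (Real.sqrt_pos.2 (by positivity))).ne'
    have h : (fun ω ↦ (ν / √n)⁻¹ • ξ ω) = (fun z : Vec n ↦ (ν / √n)⁻¹ • z) ∘ ξ := rfl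
    rw [h, ← AEMeasurable.map_map_of_aemeasurable (by fun_prop) hξ.aemeasurable, hξ.map_eq,
      noiseLaw_eq_map, Measure.map_map (by fun_prop) (by fun_prop)]
    have h' : (fun z : Vec n ↦ (ν / √n)⁻¹ • z) ∘ (fun z ↦ (ν / √n) • z) = id := by
      ext1 z
      exact inv_smul_smul₀ hs z
    rw [h', Measure.map_id]

lemma integral_norm_detailProj_noise (hn : n ≠ 0) (hν : 0 < ν)
    (hξ : HasLaw ξ (noiseLaw n ν) P) :
    ∫ ω, ‖detailProj n (ξ ω)‖ ∂P =
      ν / √n * ∫ z, ‖detailProj n z‖ ∂(stdGaussian (Vec n)) := by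
  have hs : 0 < ν / √(n : ℝ) := div_pos hν (Real.sqrt_pos.2 (by positivity))
  have h := (hasLaw_inv_smul_noise hn hν hξ).integral_comp (f := fun z ↦ ‖detailProj n z‖)
    (by fun_prop)
  rw [← h, ← integral_const_mul]
  congr with ω
  simp only [Function.comp_apply]
  rw [map_smul, norm_smul, norm_inv, Real.norm_of_nonneg hs.le, mul_inv_cancel_left₀ hs.ne']

lemma norm_act_le (hn : 2 ≤ n) (hν : 0 < ν) (hξ : HasLaw ξ (noiseLaw n ν) P)
    (M : Matrix (Fin n) (Fin n) ℝ) (x : Vec n) :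
    ‖act M x‖ ≤ snr P M x ξ * ν := by
  have hn0 : n ≠ 0 := by omega
  have hs0 : 0 < √(n : ℝ) := Real.sqrt_pos.2 (by positivity)
  have hs : 0 < ν / √(n : ℝ) := div_pos hν hs0
  have hE := integral_norm_detailProj_noise hn0 hν hξ
  have hpos : 0 < ∫ ω, ‖detailProj n (ξ ω)‖ ∂P :=
    hE ▸ mul_pos hs (integral_norm_detailProj_stdGaussian_pos hn)
  have hle : ∫ ω, ‖detailProj n (ξ ω)‖ ∂P ≤ ν := by
    rw [hE]
    calc _ ≤ ν / √n * √n := mul_le_mul_of_nonneg_left (integral_norm_detailProj_stdGaussian_le hn0) hs.le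
      _ = ν := div_mul_cancel₀ _ hs0.ne'
  have hsnr : ‖act M x‖ = snr P M x ξ * ∫ ω, ‖detailProj n (ξ ω)‖ ∂P := by
    rw [snr, div_mul_cancel₀ _ hpos.ne']
  have h0 : 0 ≤ snr P M x ξ := div_nonneg (norm_nonneg _) hpos.le
  exact hsnr.trans_le (mul_le_mul_of_nonneg_left hle h0)

end noise

lemma norm_normalizedOutput_smul_sub_le (hn : n ≠ 0) (M : Matrix (Fin n) (Fin n) ℝ) {x z : Vec n}
    {ν γ : ℝ} (hν : 0 < ν) (hx : ‖act M x‖ ≤ γ * ν) (hz : √n / 2 ≤ ‖detailProj n z‖) :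
    ‖normalizedOutput M x ((ν / √n) • z) - detailDir z‖ ≤ 4 * γ := by
  have hs0 : 0 < √(n : ℝ) := Real.sqrt_pos.2 (by positivity)
  have hs : 0 < ν / √(n : ℝ) := div_pos hν hs0
  have hP : ν / 2 ≤ ‖detailProj n ((ν / √n) • z)‖ := by
    rw [map_smul, norm_smul, Real.norm_of_nonneg hs.le]
    calc ν / 2 = ν / √n * (√n / 2) := by field_simp
      _ ≤ _ := by gcongr
  have hP0 : 0 < ‖detailProj n ((ν / √n) • z)‖ := (half_pos hν).trans_le hP
  have h := norm_normalizedOutput_sub_detailDir_le hn M x (norm_pos_iff.1 hP0)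
  rw [detailDir_smul hs] at h
  refine h.trans ((div_le_div_of_nonneg_left (by positivity) (half_pos hν) hP).trans ?_)
  rw [div_le_iff₀ (half_pos hν)]
  linarith

end Collapse

/-! ### Near-orthogonality of the two outputs -/

open Collapse in
theorem mainTheorem1 :
    ∃ c C : ℝ, 0 < c ∧ 0 < C ∧
      ∀ (n : ℕ), 2 ≤ n →
      ∀ (M : Matrix (Fin n) (Fin n) ℝ), M ∈ doublyStochastic ℝ (Fin n) → M.IsPrimitive →
      ∀ (x x' : Collapse.Vec n), x ∈ Collapse.detailSubspace n → x' ∈ Collapse.detailSubspace n →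
      ∀ (ν : ℝ), 0 < ν →
      ∀ (Ω : Type*) [MeasurableSpace Ω] (P : Measure Ω) [IsProbabilityMeasure P]
        (ξ ξ' : Ω → Collapse.Vec n),
        HasLaw ξ (Collapse.noiseLaw n ν) P → HasLaw ξ' (Collapse.noiseLaw n ν) P →
        IndepFun ξ ξ' P →
      ∀ (γ : ℝ), γ = max (Collapse.snr P M x ξ) (Collapse.snr P M x' ξ') → γ ≤ 1 / 8 →
      ∀ (ε δ : ℝ), 0 < ε → δ ∈ Set.Ioo (0 : ℝ) 1 →
        1 - δ - C * Real.exp (-(c * n * ε ^ 2)) ≤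
          P.real {ω | |inner ℝ (Collapse.normalizedOutput M x (ξ ω))
            (Collapse.normalizedOutput M x' (ξ' ω))| ≤ ε + 8 * γ} := by
  -- `8 = 3 + 3 + 2` sums the prefactors of the three bad events; `1/16` is the smallest of their
  -- rates when `ε ≤ 1`.
  refine ⟨1 / 16, 8, by norm_num, by norm_num, ?_⟩
  intro n hn M _ _ x x' _ _ ν hν Ω _ P _ ξ ξ' hξ hξ' hind γ hγ _ ε δ hε hδ
  have hn0 : n ≠ 0 := by omega
  have hs0 : 0 < √(n : ℝ) := Real.sqrt_pos.2 (by positivity)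
  have hs2 : (√(n : ℝ)) ^ 2 = n := Real.sq_sqrt (by positivity)
  have hs : 0 < ν / √(n : ℝ) := div_pos hν hs0
  have hx : ‖act M x‖ ≤ γ * ν :=
    (norm_act_le hn hν hξ M x).trans (by gcongr; exact hγ ▸ le_max_left _ _)
  have hx' : ‖act M x'‖ ≤ γ * ν :=
    (norm_act_le hn hν hξ' M x').trans (by gcongr; exact hγ ▸ le_max_right _ _)
  have hγ0 : 0 ≤ γ := nonneg_of_mul_nonneg_left ((norm_nonneg _).trans hx) hν
  set G := {ω | |inner ℝ (normalizedOutput M x (ξ ω)) (normalizedOutput M x' (ξ' ω))| ≤ ε + 8 * γ}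
    with hG
  -- For `ε > 1` Cauchy–Schwarz suffices; for `ε ≤ 1`, `exp(-n/16)` is absorbed into `exp(-nε²/16)`.
  rcases lt_or_ge 1 ε with h1 | h1
  · have hGu : G = Set.univ := by
      refine Set.eq_univ_of_forall fun ω ↦ ?_
      have h := abs_real_inner_le_norm (normalizedOutput M x (ξ ω)) (normalizedOutput M x' (ξ' ω))
      have h2 := mul_le_one₀ (norm_normalizedOutput_le hn0 M x (ξ ω)) (norm_nonneg _)
        (norm_normalizedOutput_le hn0 M x' (ξ' ω))
      simp only [hG, Set.mem_ofPred_eq]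
      linarith
    rw [hGu, probReal_univ]
    have := Real.exp_pos (-(1 / 16 * n * ε ^ 2))
    linarith [hδ.1]
  set ζ : Ω → Vec n := fun ω ↦ (ν / √n)⁻¹ • ξ ω with hζdef
  set ζ' : Ω → Vec n := fun ω ↦ (ν / √n)⁻¹ • ξ' ω with hζ'def
  have hζ : HasLaw ζ (stdGaussian (Vec n)) P := hasLaw_inv_smul_noise hn0 hν hξ
  have hζ' : HasLaw ζ' (stdGaussian (Vec n)) P := hasLaw_inv_smul_noise hn0 hν hξ'
  have hindζ : IndepFun ζ ζ' P :=
    hind.comp (φ := fun z ↦ (ν / √n)⁻¹ • z) (ψ := fun z ↦ (ν / √n)⁻¹ • z) (by fun_prop)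
      (by fun_prop)
  have hξζ (ω : Ω) : ξ ω = (ν / √n) • ζ ω := (smul_inv_smul₀ hs.ne' _).symm
  have hξζ' (ω : Ω) : ξ' ω = (ν / √n) • ζ' ω := (smul_inv_smul₀ hs.ne' _).symm
  set B := {ω | ‖detailProj n (ζ ω)‖ < √n / 2}
  set B' := {ω | ‖detailProj n (ζ' ω)‖ < √n / 2}
  -- Outside `B'`, division by `‖P_⊥ ζ'‖ ≥ √n / 2` turns this threshold into `ε`.
  set D := {ω | ε * (√n / 2) ≤ |inner ℝ (detailDir (ζ ω)) (ζ' ω)|}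
  have hmeas : MeasurableSet {z : Vec n | ‖detailProj n z‖ < √n / 2} :=
    measurableSet_lt (by fun_prop) measurable_const
  have hB : P.real B ≤ 3 * Real.exp (-(n / 16)) :=
    (hζ.measureReal_eq (p := fun z ↦ ‖detailProj n z‖ < √n / 2) hmeas).trans_le
      (stdGaussian_norm_detailProj_lt hn0)
  have hB' : P.real B' ≤ 3 * Real.exp (-(n / 16)) :=
    (hζ'.measureReal_eq (p := fun z ↦ ‖detailProj n z‖ < √n / 2) hmeas).trans_le
      (stdGaussian_norm_detailProj_lt hn0)
  have hD : P.real D ≤ 2 * Real.exp (-(ε * (√n / 2)) ^ 2 / 2) :=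
    measure_le_abs_inner_detailDir hζ hζ' hindζ (by positivity)
  -- Covering the whole space, instead of taking complements, needs no measurability of `G`.
  have hcover : Set.univ ⊆ G ∪ (B ∪ B' ∪ D) := by
    intro ω _
    by_contra hcon
    simp only [Set.mem_union, not_or] at hcon
    obtain ⟨hωG, ⟨hωB, hωB'⟩, hωD⟩ := hcon
    simp only [B, B', D, Set.mem_ofPred_eq, not_lt, not_le] at hωB hωB' hωD
    apply hωG
    have hu := norm_normalizedOutput_smul_sub_le hn0 M hν hx hωB
    have hv := norm_normalizedOutput_smul_sub_le hn0 M hν hx' hωB'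
    rw [← hξζ] at hu
    rw [← hξζ'] at hv
    have h := abs_inner_le_of_norm_sub_le (norm_normalizedOutput_le hn0 M x' (ξ' ω))
      (norm_detailDir_le (ζ ω)) hu hv
    have hdir : |inner ℝ (detailDir (ζ ω)) (detailDir (ζ' ω))| ≤ ε := by
      have hpos : 0 < ‖detailProj n (ζ' ω)‖ := (half_pos hs0).trans_le hωB'
      rw [inner_detailDir_detailDir hn0, abs_mul, abs_inv, abs_norm, inv_mul_le_iff₀' hpos]
      exact hωD.le.trans (by gcongr)
    simp only [hG, Set.mem_ofPred_eq]
    linarith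
  have htotal : 1 ≤ P.real G + (P.real B + P.real B' + P.real D) := by
    rw [← probReal_univ (μ := P)]
    refine (measureReal_mono hcover).trans ((measureReal_union_le _ _).trans ?_)
    gcongr
    refine (measureReal_union_le _ _).trans ?_
    gcongr
    exact measureReal_union_le _ _
  have hε2 : ε ^ 2 ≤ 1 := pow_le_one₀ hε.le h1
  have hn' : (0 : ℝ) ≤ n := by positivity
  have e1 : Real.exp (-(n / 16)) ≤ Real.exp (-(1 / 16 * n * ε ^ 2)) := by
    rw [Real.exp_le_exp]
    nlinarith
  have e2 : Real.exp (-(ε * (√n / 2)) ^ 2 / 2) ≤ Real.exp (-(1 / 16 * n * ε ^ 2)) := by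
    rw [Real.exp_le_exp, mul_pow, div_pow, hs2]
    nlinarith [mul_nonneg hn' (sq_nonneg ε)]
  linarith [hδ.1]
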